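/- **Conventions.** Rings are associative with unit and two-sided Noetherian where stated, modules are left modules unless specified otherwise, and $R$-mod denotes the category of finitely generated left $R$-modules. For $\omega\in R$-mod, $\mathrm{add}\,\omega$ is the class of modules isomorphic to direct summands of finite direct sums of copies of $\omega$. A left $\mathrm{add}\,\omega$-approximation of $X$ is a homomorphism $X\to C$ with $C\in\mathrm{add}\,\omega$ such that $\mathrm{Hom}_R(C,Y)\to\mathrm{Hom}_R(X,Y)$ is surjective for every $Y\in\mathrm{add}\,\omega$. *Wakamatsu tilting.* A module $\omega\in R$-mod is Wakamatsu tilting if $\mathrm{Ext}^i_R(\omega,\omega)=0$ for all $i\ge 1$ and, for every $n\ge1$, there is an exact sequence $0\to R\xrightarrow{f_1}\omega_1\xrightarrow{f_2}\cdots\xrightarrow{f_n}\omega_n$ in $R$-mod such that each inclusion $\mathrm{Im}\,f_i\to\omega_i$ $(1\le i\le n)$ is a left $\mathrm{add}\,\omega$-approximation. *Extensions.* A ring homomorphism $l:R\to S$ is a Frobenius extension $S/R$ if ${}_RS$ is finitely generated projective and ${}_SS_R\cong\mathrm{Hom}_R({}_RS_S,{}_RR_R)$ as $S$-$R$-bimodules.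 The bimodule ${}_RS_R$ is centrally projective over $R$ if it is a direct summand, as an $R$-$R$-bimodule, of a finite direct sum of copies of ${}_RR_R$. *Generalized G-dimension.* Let $\omega\in R$-mod and let $T=\mathrm{End}_R(\omega)$ act on $\omega$ from the right; put $M^\omega=\mathrm{Hom}_R(M,\omega)$, a right $T$-module. A module $M\in R$-mod has generalized G-dimension zero with respect to $\omega$ if the evaluation map $M\to\mathrm{Hom}_{T^{\mathrm{op}}}(M^\omega,\omega)$ is an isomorphism and $\mathrm{Ext}^i_R(M,\omega)=0=\mathrm{Ext}^i_{T^{\mathrm{op}}}(M^\omega,\omega)$ for all $i\ge1$; write $\mathcal G_\omega$ for the class of such modules. For $M\in R$-mod, $\mathrm{G\text{-}dim}_\omega(M)\in\mathbb N\cup\{\infty\}$ is the infimum of all integers $n\ge 0$ for which there is an exact sequence $0\to G_n\to\cdots\to G_1\to G_0\to M\to0$ with all $G_i\in\mathcal G_\omega$ (and $\infty$ if there is no such $n$). The same definitions apply over $S$. **Theorem.** Let $R$ and $S$ be two-sided Noetherian rings, let $S/R$ be a Frobenius extension with ${}_RS_R$ centrally projective over $R$, and let ${}_R\omega$ be a Wakamatsu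 tilting module. Then for every finitely generated $S$-module $M$, $$\mathrm{G\text{-}dim}_{S\otimes_R\omega}(M)=\mathrm{G\text{-}dim}_\omega(M),$$ where the left side is computed for $M$ over $S$ with respect to the $S$-module $S\otimes_R\omega$, and the right side for the underlying $R$-module of $M$ with respect to $\omega$; in particular one side is infinite if and only if the other is. -/

import Mathlib

universe u

namespace RelG

open CategoryTheory

/-! Modules are left modules; a ring extension is a ring homomorphism `l : R →+* S`. -/

section Extensions

variable {R S : Type u} [Ring R] [Ring S]

/-- The underlying `R`-module of an `S`-module `M` along `l : R →+* S`: the same abelian group,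
with `r • m = l r • m`. -/
def Restrict (_l : R →+* S) (M : Type u) : Type u := M

/-- The identity map from `M` to its underlying `R`-module. -/
def toRestrict (l : R →+* S) {M : Type u} (m : M) : Restrict l M := m

instance (l : R →+* S) (M : Type u) [AddCommGroup M] : AddCommGroup (Restrict l M) :=
  inferInstanceAs (AddCommGroup M)

instance (l : R →+* S) (M : Type u) [AddCommGroup M] [Module S M] : Module R (Restrict l M) :=
  Module.compHom M l

/-- `S / R` is a Frobenius extension: `S` is finitely generated projective as a left `R`-module,
and `S` is isomorphic to `Hom_R(S, R)` as an `S`-`R`-bimodule, where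
`(s • φ) x = φ (x * s)` and `(φ • r) x = φ x * r` for `φ` in `Hom_R(S, R)`. -/
structure IsFrobeniusExtension (l : R →+* S) : Prop where
  finite : Module.Finite R (Restrict l S)
  projective : Module.Projective R (Restrict l S)
  exists_iso : ∃ Θ : S ≃+ (Restrict l S →ₗ[R] R),
    (∀ s t x : S, Θ (s * t) (toRestrict l x) = Θ t (toRestrict l (x * s))) ∧
    (∀ (s : S) (r : R) (x : S), Θ (s * l r) (toRestrict l x) = Θ s (toRestrict l x) * r)

/-- The `R`-`R`-bimodule `S` is centrally projective over `R`, i.e. it is a direct summand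
(as a bimodule) of a finite direct sum of copies of the bimodule `R`: there are bimodule
homomorphisms `i : S → Rⁿ` and `p : Rⁿ → S` with `p ∘ i = id`. -/
def IsCentrallyProjective (l : R →+* S) : Prop :=
  ∃ (n : ℕ) (i : S →+ (Fin n → R)) (p : (Fin n → R) →+ S),
    (∀ (r : R) (s : S) (r' : R), i (l r * s * l r') = fun k => r * i s k * r') ∧
    (∀ (r : R) (v : Fin n → R) (r' : R), p (fun k => r * v k * r') = l r * p v * l r') ∧
    ∀ s : S, p (i s) = s

/-- The induced `S`-module `S ⊗_R N` of a left `R`-module `N` over a possibly noncommutative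
ring `R`: the quotient of `S ⊗_ℤ N` (with `S` acting on the left factor) by the elements
`(s * l r) ⊗ x - s ⊗ (r • x)`. -/
abbrev Induced (l : R →+* S) (N : Type u) [AddCommGroup N] [Module R N] : Type u :=
  TensorProduct ℤ S N ⧸ Submodule.span S
    {z : TensorProduct ℤ S N | ∃ (s : S) (r : R) (x : N),
      z = TensorProduct.tmul ℤ (s * l r) x - TensorProduct.tmul ℤ s (r • x)}

end Extensions

section Modules

variable (R : Type u) [Ring R] (ω : Type u) [AddCommGroup ω] [Module R ω]

/-- `Ext^i_R(M, N) = 0` for all `i ≥ 1`. -/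
def ExtVanish (M N : Type u) [AddCommGroup M] [Module R M] [AddCommGroup N] [Module R N] : Prop :=
  ∀ i : ℕ, 1 ≤ i → Subsingleton (Abelian.Ext (ModuleCat.of R M) (ModuleCat.of R N) i)

/-- `N` belongs to `add ω`: it is isomorphic to a direct summand of a finite direct sum of
copies of `ω`. -/
def InAdd (N : Type u) [AddCommGroup N] [Module R N] : Prop :=
  ∃ (n : ℕ) (i : N →ₗ[R] (Fin n → ω)) (p : (Fin n → ω) →ₗ[R] N), p ∘ₗ i = LinearMap.id

/-- `f : X → C` is a left `add ω`-approximation of `X`: `C` is in `add ω` and every homomorphism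
from `X` to a module in `add ω` factors through `f`. -/
def IsLeftAddApprox {X C : Type u} [AddCommGroup X] [Module R X] [AddCommGroup C] [Module R C]
    (f : X →ₗ[R] C) : Prop :=
  InAdd R ω C ∧ ∀ Y : ModuleCat.{u} R, InAdd R ω Y →
    ∀ g : X →ₗ[R] Y, ∃ h : C →ₗ[R] Y, h ∘ₗ f = g

/-- The faithful dimension of `ω` is at least `n`: there is an exact sequence
`0 → R → C 1 → C 2 → ⋯ → C n` (with `C 0` a copy of `R`, and `f i : C i → C (i + 1)`) such that
the inclusion of the image of `f i` into `C (i + 1)` is a left `add ω`-approximation for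
`0 ≤ i < n`. Terms and maps beyond `C n` are irrelevant. -/
def FaithfulDimGE (n : ℕ) : Prop :=
  ∃ (C : ℕ → ModuleCat.{u} R) (f : ∀ i, C i →ₗ[R] C (i + 1)),
    Nonempty (C 0 ≃ₗ[R] R) ∧
    (1 ≤ n → Function.Injective (f 0)) ∧
    (∀ i, i + 1 < n → Function.Exact (f i) (f (i + 1))) ∧
    ∀ i, i < n → IsLeftAddApprox R ω (LinearMap.range (f i)).subtype

/-- `ω` is a Wakamatsu tilting module: a finitely generated self-orthogonal module of infinite
faithful dimension. -/
structure IsWakamatsuTilting : Prop where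
  finite : Module.Finite R ω
  selfOrthogonal : ExtVanish R ω ω
  faithfulDim : ∀ n : ℕ, 1 ≤ n → FaithfulDimGE R ω n

/-! The endomorphism ring `T` of `ω` acts on the right of `ω` when endomorphisms are written on
the right. `Module.End R ω`, whose product is composition of maps written on the left, is the
opposite ring of that `T`; so right `T`-modules are left `Module.End R ω`-modules. The dual
`Hom_R(M, ω)` carries the action `e • f = e ∘ f`. -/

/-- The evaluation map `σ_M : M → Hom_T(Hom_R(M, ω), ω)`, `σ_M m f = f m`. -/
def evalMap (M : Type u) [AddCommGroup M] [Module R M] :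
    M →+ ((M →ₗ[R] ω) →ₗ[Module.End R ω] ω) where
  toFun m :=
    { toFun := fun f => f m
      map_add' := fun _ _ => rfl
      map_smul' := fun _ _ => rfl }
  map_zero' := by ext f; simp
  map_add' a b := by ext f; simp

/-- The class of modules of generalized Gorenstein dimension zero with respect to `ω`: finitely
generated `ω`-reflexive modules `M` such that `Ext^i_R(M, ω) = 0` and
`Ext^i_{T^op}(Hom_R(M, ω), ω) = 0` for all `i ≥ 1`. -/
structure IsGDimZero (M : Type u) [AddCommGroup M] [Module R M] : Prop where
  finite : Module.Finite R M
  reflexive : Function.Bijective (evalMap R ω M)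
  ext_eq_zero : ExtVanish R M ω
  ext_dual_eq_zero : ExtVanish (Module.End R ω) (M →ₗ[R] ω) ω

/-- There is an exact sequence `0 → G n → ⋯ → G 1 → G 0 → M → 0` with all `G i` of generalized
Gorenstein dimension zero with respect to `ω`. (The sequence is continued by zero modules.) -/
def HasGResolution (M : Type u) [AddCommGroup M] [Module R M] (n : ℕ) : Prop :=
  ∃ (G : ℕ → ModuleCat.{u} R) (d : ∀ i, G (i + 1) →ₗ[R] G i) (ε : G 0 →ₗ[R] M),
    (∀ i, i ≤ n → IsGDimZero R ω (G i)) ∧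
    (∀ i, n < i → Subsingleton (G i)) ∧
    (∀ i, Function.Exact (d (i + 1)) (d i)) ∧
    Function.Exact (d 0) ε ∧
    Function.Surjective ε

/-- The generalized G-dimension of `M` with respect to `ω`; it is `⊤` if there is no finite
resolution as above. -/
noncomputable def gDim (M : Type u) [AddCommGroup M] [Module R M] : ℕ∞ :=
  sInf {k : ℕ∞ | ∃ n : ℕ, k = n ∧ HasGResolution R ω M n}

end Modules

end RelG

/-!
The theorem follows from two facts.

*G-dimension zero does not change under restriction* (`isGDimZero_iff`). Let `φ : A → B` be a ring
homomorphism. A `B`-module `W` with an `A`-linear map `π : W → V` is called coinduced from `V`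
(`IsCoinduced`) if composition with `π` is a bijection `Hom_B(M, W) → Hom_A(M, V)` for all
`B`-modules `M`. If `B` is moreover projective over `A`, then dimension shifting shows that
`Ext_B(M, W)` and `Ext_A(M, V)` vanish together (`IsCoinduced.extVanish_iff`). This is used twice,
with the same `π : S ⊗_R ω → ω`: for `R → S`, and for the homomorphism `t ↦ S ⊗ t` between the
endomorphism rings of `ω` and of `S ⊗_R ω`. Since `S / R` is Frobenius and centrally projective,
it has a Frobenius system `E, x, y` whose dual bases commute with `R`
(`exists_centralFrobeniusSystem`), and `π` is `s ⊗ v ↦ E s • v`. Because `x` and `y` commute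
with `R`, right multiplications by them are endomorphisms of `S ⊗_R ω`, and they form a Frobenius
system of the extension of endomorphism rings (`endSystem`). In both cases the system expresses
every element of `S ⊗_R ω` through its images under `π`, so that `S ⊗_R ω` is coinduced and the
larger ring is projective over the smaller one (`FrobeniusSystem.isCoinduced`,
`FrobeniusSystem.projective`). The vanishing of both kinds of `Ext`, and the bijectivity of the
evaluation map, can then be tested over `R` and `End_R(ω)`.

*Syzygies* (`HasGResolution.ker_of_projective`). If `M` has G-dimension at most `n + 1`, then the
kernel of a surjection onto `M` from a finitely generated projective module has G-dimension at
most `n`. This needs only that projective modules have G-dimension zero, which is where `ω` being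
Wakamatsu tilting enters (`FaithfulDimGE.self`), and that modules of G-dimension zero are closed
under finite direct sums, direct summands and kernels of surjections.

A resolution over `S` restricts to one over `R` by the first fact. Conversely, if `M` has a
resolution of length `n` over `R`, then the `n`-th syzygy of `M` over `S` has G-dimension zero
over `R` by the second fact, and hence over `S` by the first.
-/

namespace RelG

open CategoryTheory

/-! ### Vanishing of `Ext` for modules -/

section Ext

variable {R : Type u} [Ring R]
variable {A B C N : Type u} [AddCommGroup A] [Module R A] [AddCommGroup B] [Module R B]
  [AddCommGroup C] [Module R C] [AddCommGroup N] [Module R N]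

/-- `Ext^i_R(M, N) = 0` for the single degree `i`. -/
def ExtVanishAt (R : Type u) [Ring R] (i : ℕ) (M N : Type u) [AddCommGroup M] [Module R M]
    [AddCommGroup N] [Module R N] : Prop :=
  Subsingleton (Abelian.Ext (ModuleCat.of R M) (ModuleCat.of R N) i)

theorem shortExact_of {f : A →ₗ[R] B} {g : B →ₗ[R] C} (hf : Function.Injective f)
    (hfg : Function.Exact f g) (hg : Function.Surjective g) :
    (ShortComplex.mk (ModuleCat.ofHom f) (ModuleCat.ofHom g)
      (by ext x; exact hfg.apply_apply_eq_zero x)).ShortExact where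
  exact := (ShortComplex.ShortExact.moduleCat_exact_iff_function_exact _).mpr hfg
  mono_f := (ModuleCat.mono_iff_injective _).mpr hf
  epi_g := (ModuleCat.epi_iff_surjective _).mpr hg

theorem ExtVanishAt.of_projective [Module.Projective R A] (i : ℕ) : ExtVanishAt R (i + 1) A N :=
  Abelian.Ext.subsingleton_of_projective ..

theorem ExtVanish.of_projective [Module.Projective R A] : ExtVanish R A N := by
  intro i hi
  obtain ⟨i, rfl⟩ := Nat.exists_eq_add_of_le' hi
  exact ExtVanishAt.of_projective i

/-- Families of maps `a k : A → G k` and `b k : G k → A` with `∑ k, b k ∘ a k = id` present `A` as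
a direct summand of the direct sum of the `G k`. -/
theorem extVanishAt_of_sum_comp_eq_id {ι : Type*} [Fintype ι] {G : ι → Type u}
    [∀ k, AddCommGroup (G k)] [∀ k, Module R (G k)] (a : ∀ k, A →ₗ[R] G k) (b : ∀ k, G k →ₗ[R] A)
    (hab : ∀ x, ∑ k, b k (a k x) = x) {i : ℕ} (hG : ∀ k, ExtVanishAt R i (G k) N) :
    ExtVanishAt R i A N := by
  refine subsingleton_of_forall_eq 0 fun x => ?_
  have hid : 𝟙 (ModuleCat.of R A) = ∑ k, ModuleCat.ofHom (a k) ≫ ModuleCat.ofHom (b k) := by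
    ext x
    simp [ModuleCat.hom_sum, hab]
  rw [← Abelian.Ext.mk₀_id_comp x, hid, Abelian.Ext.mk₀_sum, Abelian.Ext.sum_comp]
  refine Finset.sum_eq_zero fun k _ => ?_
  have : Subsingleton (Abelian.Ext (ModuleCat.of R (G k)) (ModuleCat.of R N) i) := hG k
  rw [← Abelian.Ext.mk₀_comp_mk₀_assoc,
    Subsingleton.elim ((Abelian.Ext.mk₀ (ModuleCat.ofHom (b k))).comp x (zero_add i)) 0,
    Abelian.Ext.comp_zero]

theorem ExtVanish.congr (e : A ≃ₗ[R] B) (h : ExtVanish R A N) : ExtVanish R B N := fun i hi =>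
  extVanishAt_of_sum_comp_eq_id (ι := Unit) (G := fun _ => A) (fun _ => e.symm.toLinearMap)
    (fun _ => e.toLinearMap) (by simp) fun _ => h i hi

variable {f : A →ₗ[R] B} {g : B →ₗ[R] C} (hf : Function.Injective f) (hfg : Function.Exact f g)
  (hg : Function.Surjective g) {i : ℕ}

include hf hfg hg

theorem ExtVanishAt.right (hA : ExtVanishAt R i A N) (hB : ExtVanishAt R (i + 1) B N) :
    ExtVanishAt R (i + 1) C N := by
  refine subsingleton_of_forall_eq 0 fun x => ?_
  obtain ⟨y, rfl⟩ := Abelian.Ext.contravariant_sequence_exact₃ (shortExact_of hf hfg hg) _ x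
    (@Subsingleton.elim _ hB _ _) (add_comm 1 i)
  rw [@Subsingleton.elim _ hA y 0, Abelian.Ext.comp_zero]

theorem ExtVanishAt.left (hB : ExtVanishAt R i B N) (hC : ExtVanishAt R (i + 1) C N) :
    ExtVanishAt R i A N := by
  refine subsingleton_of_forall_eq 0 fun x => ?_
  obtain ⟨y, rfl⟩ := Abelian.Ext.contravariant_sequence_exact₁ (shortExact_of hf hfg hg) _ x
    (add_comm 1 i) (@Subsingleton.elim _ hC _ _)
  rw [@Subsingleton.elim _ hB y 0, Abelian.Ext.comp_zero]

theorem ExtVanishAt.exists_extension (hC : ExtVanishAt R 1 C N) (φ : A →ₗ[R] N) :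
    ∃ ψ : B →ₗ[R] N, ψ ∘ₗ f = φ := by
  obtain ⟨y, hy⟩ := Abelian.Ext.contravariant_sequence_exact₁ (shortExact_of hf hfg hg) _
    (Abelian.Ext.mk₀ (ModuleCat.ofHom φ)) (add_zero 1) (@Subsingleton.elim _ hC _ _)
  obtain ⟨ψ, rfl⟩ := (Abelian.Ext.mk₀_bijective _ _).2 y
  rw [Abelian.Ext.mk₀_comp_mk₀] at hy
  have h := (Abelian.Ext.mk₀_bijective _ _).1 hy
  exact ⟨ψ.hom, by simpa using congrArg ModuleCat.Hom.hom h⟩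

theorem ExtVanishAt.one_of_extension (hB : ExtVanishAt R 1 B N)
    (hext : ∀ φ : A →ₗ[R] N, ∃ ψ : B →ₗ[R] N, ψ ∘ₗ f = φ) : ExtVanishAt R 1 C N := by
  refine subsingleton_of_forall_eq 0 fun x => ?_
  have hS := shortExact_of hf hfg hg
  obtain ⟨y, rfl⟩ := Abelian.Ext.contravariant_sequence_exact₃ hS _ x
    (@Subsingleton.elim _ hB _ _) (add_zero 1)
  obtain ⟨φ, rfl⟩ := (Abelian.Ext.mk₀_bijective _ _).2 y
  obtain ⟨ψ, hψ⟩ := hext φ.hom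
  have : φ = ModuleCat.ofHom f ≫ ModuleCat.ofHom ψ := by
    ext x
    exact (LinearMap.congr_fun hψ x).symm
  rw [this, ← Abelian.Ext.mk₀_comp_mk₀]
  exact hS.extClass_comp_assoc _

/-- Dimension shifting in degree one: for a presentation `0 → A → B → C → 0` with `B` projective,
`Ext¹(C, N) = 0` means that homomorphisms `A → N` extend to `B`. -/
theorem extVanishAt_one_iff [Module.Projective R B] : ExtVanishAt R 1 C N ↔
    ∀ φ : A →ₗ[R] N, ∃ ψ : B →ₗ[R] N, ψ ∘ₗ f = φ :=
  ⟨fun h => h.exists_extension hf hfg hg,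
    ExtVanishAt.one_of_extension hf hfg hg (ExtVanishAt.of_projective 0)⟩

theorem extVanishAt_add_two_iff [Module.Projective R B] :
    ExtVanishAt R (i + 2) C N ↔ ExtVanishAt R (i + 1) A N :=
  ⟨fun h => ExtVanishAt.left hf hfg hg (ExtVanishAt.of_projective i) h,
    fun h => ExtVanishAt.right hf hfg hg h (ExtVanishAt.of_projective (i + 1))⟩

end Ext

theorem exists_projective_presentation (B : Type u) [Ring B] (M : Type u) [AddCommGroup M]
    [Module B M] : ∃ (K P : ModuleCat.{u} B) (f : K →ₗ[B] P) (g : P →ₗ[B] M),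
      Module.Projective B P ∧ Function.Injective f ∧ Function.Exact f g ∧
        Function.Surjective g := by
  let g : (M →₀ B) →ₗ[B] M := Finsupp.linearCombination B id
  exact ⟨ModuleCat.of B (LinearMap.ker g), ModuleCat.of B (M →₀ B), (LinearMap.ker g).subtype, g,
    inferInstanceAs (Module.Projective B (M →₀ B)), Subtype.val_injective,
    LinearMap.exact_subtype_ker_map g, Finsupp.linearCombination_id_surjective B M⟩

/-! ### Change of rings and coinduced modules -/

section ChangeOfRings

variable {A B : Type u} [Ring A] [Ring B] (φ : A →+* B)

/-- The identity map from the underlying `A`-module of `M` to `M`. -/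
def ofRestrict {M : Type u} (m : Restrict φ M) : M := m

/-- A `B`-linear map, regarded as an `A`-linear map between the underlying `A`-modules. -/
def restrictMap {M N : Type u} [AddCommGroup M] [Module B M] [AddCommGroup N] [Module B N]
    (f : M →ₗ[B] N) : Restrict φ M →ₗ[A] Restrict φ N where
  toFun m := f m
  map_add' := f.map_add
  map_smul' a m := f.map_smul (φ a) m

/-- The underlying `A`-module of a free `B`-module is a direct sum of copies of that of `B`. -/
def restrictFinsupp (ι : Type u) : Restrict φ (ι →₀ B) ≃ₗ[A] (ι →₀ Restrict φ B) where
  toFun v := (v : ι →₀ B)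
  invFun v := (v : ι →₀ B)
  map_add' _ _ := rfl
  map_smul' _ _ := by ext; rfl
  left_inv _ := rfl
  right_inv _ := rfl

theorem projective_restrict [Module.Projective A (Restrict φ B)] (P : Type u) [AddCommGroup P]
    [Module B P] [Module.Projective B P] : Module.Projective A (Restrict φ P) := by
  obtain ⟨s, hs⟩ := Module.projective_def'.1 ‹Module.Projective B P›
  classical
  have : Module.Projective A (Restrict φ (P →₀ B)) := Module.Projective.of_equiv
    ((restrictFinsupp φ P).trans (finsuppLequivDFinsupp A)).symm
  exact Module.Projective.of_split (restrictMap φ s)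
    (restrictMap φ (Finsupp.linearCombination B id))
    (LinearMap.ext fun x => LinearMap.congr_fun hs x)

variable {W V : Type u} [AddCommGroup W] [Module B W] [AddCommGroup V] [Module A V]

/-- The `B`-module `W` is coinduced from the `A`-module `V`, with counit `π : W → V`:
composition with `π` is a bijection `Hom_B(M, W) → Hom_A(M, V)` for every `B`-module `M`. -/
def IsCoinduced (π : Restrict φ W →ₗ[A] V) : Prop :=
  ∀ (M : Type u) [AddCommGroup M] [Module B M],
    Function.Bijective fun f : M →ₗ[B] W => π ∘ₗ restrictMap φ f

variable {φ} {π : Restrict φ W →ₗ[A] V}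

/-- `Ext_B(M, W) = Ext_A(M, V)` for a coinduced module `W`, as far as vanishing is concerned.
By dimension shifting along free `B`-modules, which stay projective over `A`, this comes down to
degree one, where it is the defining property of `W`. -/
theorem IsCoinduced.extVanishAt_iff [Module.Projective A (Restrict φ B)] (hπ : IsCoinduced φ π)
    (i : ℕ) (M : Type u) [AddCommGroup M] [Module B M] :
    ExtVanishAt B (i + 1) M W ↔ ExtVanishAt A (i + 1) (Restrict φ M) V := by
  induction i generalizing M
  all_goals
    obtain ⟨K, P, f, g, hP, hf, hfg, hg⟩ := exists_projective_presentation B M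
    have hg' : Function.Surjective (restrictMap φ g) := hg
    have hf' : Function.Injective (restrictMap φ f) := hf
    have hfg' : Function.Exact (restrictMap φ f) (restrictMap φ g) := hfg
    have := projective_restrict φ P
  case zero =>
    rw [extVanishAt_one_iff hf hfg hg, extVanishAt_one_iff hf' hfg' hg']
    constructor
    · intro h γ
      obtain ⟨γ', rfl⟩ := (hπ K).2 γ
      obtain ⟨ψ, rfl⟩ := h γ'
      exact ⟨π ∘ₗ restrictMap φ ψ, rfl⟩
    · intro h γ
      obtain ⟨ψ, hψ⟩ := h (π ∘ₗ restrictMap φ γ)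
      obtain ⟨ψ', rfl⟩ := (hπ P).2 ψ
      exact ⟨ψ', (hπ _).1 hψ⟩
  case succ i ih _ _ =>
    rw [extVanishAt_add_two_iff hf hfg hg, extVanishAt_add_two_iff hf' hfg' hg']
    exact ih _

theorem IsCoinduced.extVanish_iff [Module.Projective A (Restrict φ B)] (hπ : IsCoinduced φ π)
    (M : Type u) [AddCommGroup M] [Module B M] :
    ExtVanish B M W ↔ ExtVanish A (Restrict φ M) V := by
  refine forall_congr' fun i => forall_congr' fun hi => ?_
  obtain ⟨i, rfl⟩ := Nat.exists_eq_add_of_le' hi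
  exact hπ.extVanishAt_iff i M

/-! ### Frobenius systems -/

variable (φ) in
/-- A Frobenius system of the ring extension `φ : A → B`: a left `A`-linear map `E : B → A` with
dual bases `x`, `y`. -/
structure FrobeniusSystem (n : ℕ) where
  /-- The Frobenius homomorphism. -/
  E : Restrict φ B →ₗ[A] A
  /-- The first dual basis. -/
  x : Fin n → B
  /-- The second dual basis. -/
  y : Fin n → B
  sum_left : ∀ b : B, ∑ k, φ (E (toRestrict φ (b * x k))) * y k = b
  sum_right : ∀ b : B, ∑ k, x k * φ (E (toRestrict φ (y k * b))) = b

namespace FrobeniusSystem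

variable {n : ℕ} (F : FrobeniusSystem φ n)

include F

/-- The elements `y k` and the functionals `b ↦ E (b * x k)` form a projective basis. -/
theorem projective : Module.Projective A (Restrict φ B) := by
  let s : Restrict φ B →ₗ[A] (Fin n → A) := LinearMap.pi fun k =>
    F.E ∘ₗ restrictMap φ (LinearMap.toSpanSingleton B B (F.x k))
  let p : (Fin n → A) →ₗ[A] Restrict φ B :=
    Fintype.linearCombination A fun k => toRestrict φ (F.y k)
  exact Module.Projective.of_split s p (LinearMap.ext fun b => F.sum_left b)

theorem finite_restrict (M : Type u) [AddCommGroup M] [Module B M] [Module.Finite B M] :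
    Module.Finite A (Restrict φ M) := by
  obtain ⟨m, g, hg⟩ := Module.Finite.exists_fin' B M
  refine Module.Finite.of_surjective (M := Fin n × Fin m → A)
    (Fintype.linearCombination A fun q => toRestrict φ (F.y q.1 • g (Pi.single q.2 1))) fun z => ?_
  obtain ⟨v, rfl⟩ := hg z
  refine ⟨fun q => F.E (toRestrict φ (v q.2 * F.x q.1)), ?_⟩
  have h1 : g v = ∑ j, v j • g (Pi.single j 1) := by
    conv_lhs => rw [← Finset.univ_sum_single v, map_sum]
    refine Finset.sum_congr rfl fun j _ => ?_
    rw [← map_smul, ← Pi.single_smul, smul_eq_mul, mul_one]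
  have h2 : ∀ j, v j • g (Pi.single j 1) = ∑ k, φ (F.E (toRestrict φ (v j * F.x k))) •
      F.y k • g (Pi.single j 1) := fun j => by
    conv_lhs => rw [← F.sum_left (v j), Finset.sum_smul]
    simp only [mul_smul]
  simp only [h2] at h1
  rw [h1, Finset.sum_comm, ← Fintype.sum_prod_type']
  rfl

/-- A `B`-module `W` is coinduced from `V` as soon as there is a map `ι : V → W` that turns the
dual bases into an expansion of the elements of `W`. -/
theorem isCoinduced (ι : V →ₗ[A] Restrict φ W)
    (hι : ∀ (b : B) (v : V), π (toRestrict φ (b • ofRestrict φ (ι v))) = F.E (toRestrict φ b) • v)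
    (hw : ∀ w : W, ∑ k, F.x k • ofRestrict φ (ι (π (toRestrict φ (F.y k • w)))) = w) :
    IsCoinduced φ π := by
  intro M _ _
  constructor
  · intro f f' h
    ext m
    have key : ∀ k, π (toRestrict φ (F.y k • f m)) = π (toRestrict φ (F.y k • f' m)) := by
      intro k
      have := LinearMap.congr_fun h (toRestrict φ (F.y k • m))
      rw [← map_smul, ← map_smul]
      exact this
    rw [← hw (f m), ← hw (f' m)]
    simp only [key]
  · intro g
    have hsmul : ∀ (a : A) (v : V), ofRestrict φ (ι (a • v)) = φ a • ofRestrict φ (ι v) :=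
      fun a v => ι.map_smul a v
    have hexp : ∀ (b : B) (v : V),
        b • ofRestrict φ (ι v) =
          ∑ k, F.x k • ofRestrict φ (ι (F.E (toRestrict φ (F.y k * b)) • v)) := by
      intro b v
      conv_lhs => rw [← F.sum_right b, Finset.sum_smul]
      refine Finset.sum_congr rfl fun k _ => ?_
      rw [mul_smul, hsmul]
    have hg : ∀ (b : B) (m : M), g (toRestrict φ (b • m)) =
        ∑ k, F.E (toRestrict φ (b * F.x k)) • g (toRestrict φ (F.y k • m)) := by
      intro b m
      have : toRestrict φ (b • m) =
          ∑ k, F.E (toRestrict φ (b * F.x k)) • toRestrict φ (F.y k • m) := by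
        conv_lhs => rw [← F.sum_left b, Finset.sum_smul]
        simp only [mul_smul]
        rfl
      rw [this, map_sum]
      simp only [map_smul]
    -- The only candidate: the expansion of `f m` that `hw` gives, with `π ∘ f` replaced by `g`.
    let f : M →ₗ[B] W :=
      { toFun := fun m => ∑ k, F.x k • ofRestrict φ (ι (g (toRestrict φ (F.y k • m))))
        map_add' := fun m m' => by
          rw [← Finset.sum_add_distrib]
          refine Finset.sum_congr rfl fun k _ => ?_
          rw [← smul_add, smul_add (F.y k)]
          congr 1
          exact (congrArg ι (g.map_add _ _)).trans (ι.map_add _ _)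
        map_smul' := fun b m => by
          simp only [RingHom.id_apply, Finset.smul_sum, ← mul_smul, hexp (b * F.x _)]
          rw [Finset.sum_comm]
          refine Finset.sum_congr rfl fun k _ => ?_
          rw [← Finset.smul_sum, hg]
          congr 1
          refine (map_sum ι _ _).trans ?_
          refine Finset.sum_congr rfl fun j _ => ?_
          rw [mul_assoc]
          rfl }
    refine ⟨f, LinearMap.ext fun m => ?_⟩
    let w : Fin n → V := fun k => g (toRestrict φ (F.y k • ofRestrict φ m))
    change π (toRestrict φ (∑ k, F.x k • ofRestrict φ (ι (w k)))) = g m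
    refine (map_sum π (fun k => toRestrict φ (F.x k • ofRestrict φ (ι (w k)))) _).trans ?_
    simp only [hι]
    have := hg 1 (ofRestrict φ m)
    simp only [one_mul] at this
    rw [← this, one_smul]
    rfl

end FrobeniusSystem

end ChangeOfRings

/-! ### Duals, biduals and reflexivity -/

section Duality

variable {R : Type u} [Ring R] {ω : Type u} [AddCommGroup ω] [Module R ω]
variable {A B C : Type u} [AddCommGroup A] [Module R A] [AddCommGroup B] [Module R B]
  [AddCommGroup C] [Module R C]

variable (ω) in
/-- The map `Hom_R(B, ω) → Hom_R(A, ω)` induced by `h : A → B`, as a map of modules over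
`End_R(ω)`. -/
def dualMap (h : A →ₗ[R] B) : (B →ₗ[R] ω) →ₗ[Module.End R ω] (A →ₗ[R] ω) where
  toFun f := f ∘ₗ h
  map_add' _ _ := rfl
  map_smul' _ _ := rfl

/-- `ω` is reflexive, since `Hom_R(ω, ω)` is the regular module of its endomorphism ring. -/
theorem evalMap_self_bijective : Function.Bijective (evalMap R ω ω) := by
  constructor
  · intro v w h
    exact LinearMap.congr_fun h (LinearMap.id : ω →ₗ[R] ω)
  · intro Φ
    refine ⟨Φ (LinearMap.id : ω →ₗ[R] ω), LinearMap.ext fun f => ?_⟩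
    exact (Φ.map_smul (f : Module.End R ω) (LinearMap.id : ω →ₗ[R] ω)).symm

section SumComp

variable {ι : Type*} [Fintype ι] {G : ι → Type u} [∀ k, AddCommGroup (G k)]
  [∀ k, Module R (G k)] (a : ∀ k, A →ₗ[R] G k) (b : ∀ k, G k →ₗ[R] A)
  (hab : ∀ x, ∑ k, b k (a k x) = x)

include hab

theorem evalMap_bijective_of_sum_comp_eq_id (hG : ∀ k, Function.Bijective (evalMap R ω (G k))) :
    Function.Bijective (evalMap R ω A) := by
  constructor
  · intro x y hxy
    have : ∀ k, a k x = a k y := fun k =>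
      (hG k).1 (LinearMap.ext fun f => LinearMap.congr_fun hxy (f ∘ₗ a k))
    rw [← hab x, ← hab y]
    simp only [this]
  · intro Φ
    choose g hg using fun k => (hG k).2 (Φ ∘ₗ dualMap ω (a k))
    refine ⟨∑ k, b k (g k), LinearMap.ext fun f => ?_⟩
    have hf : f = ∑ k, dualMap ω (a k) (f ∘ₗ b k) := by
      ext x
      conv_lhs => rw [← hab x]
      simp [dualMap]
    conv_rhs => rw [hf, map_sum]
    refine (map_sum f _ _).trans (Finset.sum_congr rfl fun k _ => ?_)
    exact LinearMap.congr_fun (hg k) (f ∘ₗ b k)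

theorem extVanishAt_dual_of_sum_comp_eq_id {i : ℕ}
    (hG : ∀ k, ExtVanishAt (Module.End R ω) i (G k →ₗ[R] ω) ω) :
    ExtVanishAt (Module.End R ω) i (A →ₗ[R] ω) ω := by
  refine extVanishAt_of_sum_comp_eq_id (fun k => dualMap ω (b k)) (fun k => dualMap ω (a k))
    (fun f => ?_) hG
  ext x
  conv_rhs => rw [← hab x]
  simp [dualMap]

/-- Modules of G-dimension zero are closed under finite direct sums and direct summands. -/
theorem IsGDimZero.of_sum_comp_eq_id (hG : ∀ k, IsGDimZero R ω (G k)) : IsGDimZero R ω A where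
  finite := by
    have := fun k => (hG k).finite
    classical
    refine Module.Finite.of_surjective (LinearMap.lsum R G ℕ b) fun x => ⟨fun k => a k x, ?_⟩
    simpa using hab x
  reflexive := evalMap_bijective_of_sum_comp_eq_id a b hab fun k => (hG k).reflexive
  ext_eq_zero i hi := extVanishAt_of_sum_comp_eq_id a b hab fun k => (hG k).ext_eq_zero i hi
  ext_dual_eq_zero i hi :=
    extVanishAt_dual_of_sum_comp_eq_id a b hab fun k => (hG k).ext_dual_eq_zero i hi

end SumComp

theorem IsGDimZero.congr (e : A ≃ₗ[R] B) (h : IsGDimZero R ω A) : IsGDimZero R ω B :=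
  IsGDimZero.of_sum_comp_eq_id (ι := Unit) (G := fun _ => A) (fun _ => e.symm.toLinearMap)
    (fun _ => e.toLinearMap) (by simp) fun _ => h

theorem IsGDimZero.prod (hA : IsGDimZero R ω A) (hB : IsGDimZero R ω B) :
    IsGDimZero R ω (A × B) := by
  let G : Bool → ModuleCat.{u} R := fun k => bif k then ModuleCat.of R A else ModuleCat.of R B
  refine IsGDimZero.of_sum_comp_eq_id (G := fun k => G k)
    (fun k => match k with
      | true => LinearMap.fst R A B
      | false => LinearMap.snd R A B)
    (fun k => match k with
      | true => LinearMap.inl R A B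
      | false => LinearMap.inr R A B) (fun x => ?_) (fun k => ?_)
  · exact (Fintype.sum_bool _).trans (Prod.ext (add_zero x.1) (zero_add x.2))
  · cases k
    · exact hB
    · exact hA

theorem sum_comp_single_proj {n : ℕ} {i : A →ₗ[R] (Fin n → B)} {p : (Fin n → B) →ₗ[R] A}
    (hip : p ∘ₗ i = LinearMap.id) (x : A) :
    ∑ k, (p ∘ₗ LinearMap.single R (fun _ => B) k) ((LinearMap.proj k ∘ₗ i) x) = x := by
  conv_rhs => rw [← LinearMap.id_apply (R := R) x, ← hip, LinearMap.comp_apply,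
    ← Finset.univ_sum_single (i x), map_sum]
  rfl

theorem InAdd.evalMap_bijective (h : InAdd R ω A) : Function.Bijective (evalMap R ω A) := by
  obtain ⟨n, i, p, hip⟩ := h
  exact evalMap_bijective_of_sum_comp_eq_id (ι := Fin n) (G := fun _ => ω)
    (fun k => LinearMap.proj k ∘ₗ i) (fun k => p ∘ₗ LinearMap.single R (fun _ => ω) k)
    (sum_comp_single_proj hip) fun _ => evalMap_self_bijective

theorem InAdd.extVanishAt_dual (h : InAdd R ω A) (j : ℕ) :
    ExtVanishAt (Module.End R ω) (j + 1) (A →ₗ[R] ω) ω := by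
  obtain ⟨n, i, p, hip⟩ := h
  refine extVanishAt_dual_of_sum_comp_eq_id (ι := Fin n) (G := fun _ => ω)
    (fun k => LinearMap.proj k ∘ₗ i) (fun k => p ∘ₗ LinearMap.single R (fun _ => ω) k)
    (sum_comp_single_proj hip) fun _ => ?_
  have : Module.Projective (Module.End R ω) (ω →ₗ[R] ω) :=
    inferInstanceAs (Module.Projective (Module.End R ω) (Module.End R ω))
  exact ExtVanishAt.of_projective j

variable {f : A →ₗ[R] B} {g : B →ₗ[R] C} (hf : Function.Injective f) (hfg : Function.Exact f g)
  (hg : Function.Surjective g)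

include hf in
theorem evalMap_injective_of_injective (hB : Function.Injective (evalMap R ω B)) :
    Function.Injective (evalMap R ω A) := fun _ _ h =>
  hf (hB (LinearMap.ext fun ψ => LinearMap.congr_fun h (ψ ∘ₗ f)))

include hg in
theorem dualMap_injective : Function.Injective (dualMap ω g) := fun θ θ' h =>
  LinearMap.ext fun c => by
    obtain ⟨b, rfl⟩ := hg c
    exact LinearMap.congr_fun h b

include hfg hg in
theorem dualMap_exact : Function.Exact (dualMap ω g) (dualMap ω f) := by
  intro ψ
  constructor
  · intro h
    have hker : LinearMap.ker g ≤ LinearMap.ker ψ := by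
      intro b hb
      obtain ⟨a, rfl⟩ := (hfg b).1 hb
      exact LinearMap.congr_fun h a
    refine ⟨(LinearMap.ker g).liftQ ψ hker ∘ₗ (g.quotKerEquivOfSurjective hg).symm.toLinearMap, ?_⟩
    ext b
    have : (g.quotKerEquivOfSurjective hg).symm (g b) = Submodule.Quotient.mk b := by
      rw [LinearEquiv.symm_apply_eq]
      rfl
    simp [dualMap, this]
  · rintro ⟨θ, rfl⟩
    ext a
    simp [dualMap, hfg.apply_apply_eq_zero]

variable (hext : ∀ φ : A →ₗ[R] ω, ∃ ψ : B →ₗ[R] ω, ψ ∘ₗ f = φ)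

include hf hfg hext in
/-- If every homomorphism `A → ω` extends to `B`, with `B` reflexive and `C` torsionless, then `A`
is reflexive: an element of `A^ωω` comes from some `b` in `B`, and `g b = 0` because all
homomorphisms `C → ω` kill it. -/
theorem evalMap_bijective_left (hB : Function.Bijective (evalMap R ω B))
    (hC : Function.Injective (evalMap R ω C)) : Function.Bijective (evalMap R ω A) := by
  refine ⟨evalMap_injective_of_injective hf hB.1, fun Φ => ?_⟩
  obtain ⟨b, hb⟩ := hB.2 (Φ ∘ₗ dualMap ω f)
  have hgb : g b = 0 := by
    apply hC
    rw [map_zero]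
    ext θ
    have h0 : dualMap ω f (θ ∘ₗ g) = 0 := by
      ext a
      simp [dualMap, hfg.apply_apply_eq_zero]
    refine (LinearMap.congr_fun hb (θ ∘ₗ g)).trans ?_
    rw [LinearMap.comp_apply, h0, map_zero]
    rfl
  obtain ⟨a, rfl⟩ := (hfg b).1 hgb
  refine ⟨a, LinearMap.ext fun φ => ?_⟩
  obtain ⟨ψ, rfl⟩ := hext φ
  exact LinearMap.congr_fun hb ψ

include hfg hg hext

/-- If `C` is reflexive (or just `C → C^ωω` is onto), then `B^ωω → C^ωω` is onto, so that
`Ext¹(A^ω, ω)` embeds into `Ext¹(B^ω, ω)`. -/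
theorem extVanishAt_one_dual (hC : Function.Surjective (evalMap R ω C))
    (hB : ExtVanishAt (Module.End R ω) 1 (B →ₗ[R] ω) ω) :
    ExtVanishAt (Module.End R ω) 1 (A →ₗ[R] ω) ω := by
  refine ExtVanishAt.one_of_extension (dualMap_injective hg) (dualMap_exact hfg hg) hext hB
    fun α => ?_
  obtain ⟨c, rfl⟩ := hC α
  obtain ⟨b, rfl⟩ := hg c
  exact ⟨evalMap R ω B b, rfl⟩

theorem extVanishAt_succ_dual {i : ℕ}
    (hC : ExtVanishAt (Module.End R ω) i (C →ₗ[R] ω) ω)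
    (hB : ExtVanishAt (Module.End R ω) (i + 1) (B →ₗ[R] ω) ω) :
    ExtVanishAt (Module.End R ω) (i + 1) (A →ₗ[R] ω) ω :=
  ExtVanishAt.right (dualMap_injective hg) (dualMap_exact hfg hg) hext hC hB

omit hext in
include hf in
/-- Modules of G-dimension zero are closed under kernels of surjections. -/
theorem IsGDimZero.left [IsNoetherianRing R] (hB : IsGDimZero R ω B) (hC : IsGDimZero R ω C) :
    IsGDimZero R ω A := by
  have hext := (show ExtVanishAt R 1 C ω from hC.ext_eq_zero 1 le_rfl).exists_extension hf hfg hg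
  refine ⟨?_, evalMap_bijective_left hf hfg hext hB.reflexive hC.reflexive.1, fun i hi => ?_,
    fun i hi => ?_⟩
  · have := hB.finite
    exact Module.Finite.of_injective f hf
  · exact ExtVanishAt.left hf hfg hg (hB.ext_eq_zero i hi) (hC.ext_eq_zero (i + 1) (by omega))
  · obtain ⟨i, rfl⟩ := Nat.exists_eq_add_of_le' hi
    rcases i with _ | i
    · exact extVanishAt_one_dual hfg hg hext hC.reflexive.2 (hB.ext_dual_eq_zero 1 le_rfl)
    · exact extVanishAt_succ_dual hfg hg hext (hC.ext_dual_eq_zero (i + 1) (by omega))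
        (hB.ext_dual_eq_zero (i + 2) (by omega))

end Duality

/-! ### The base ring has G-dimension zero -/

section Wakamatsu

variable {R : Type u} [Ring R] {ω : Type u} [AddCommGroup ω] [Module R ω]

theorem inAdd_self : InAdd R ω ω :=
  ⟨1, LinearMap.pi fun _ => LinearMap.id, LinearMap.proj 0, rfl⟩

theorem IsLeftAddApprox.exists_extension {X C : Type u} [AddCommGroup X] [Module R X]
    [AddCommGroup C] [Module R C] {f : X →ₗ[R] C} (hf : IsLeftAddApprox R ω f) (φ : X →ₗ[R] ω) :
    ∃ ψ : C →ₗ[R] ω, ψ ∘ₗ f = φ :=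
  hf.2 (ModuleCat.of R ω) inAdd_self φ

/-- In a sequence of left `add ω`-approximations of length `n`, every image is `ω`-torsionless,
hence every image but the last is reflexive, hence `Ext¹(-^ω, ω)` vanishes on all but the last two;
each further step shifts the vanishing by one degree. -/
theorem FaithfulDimGE.self {n : ℕ} (h : FaithfulDimGE R ω (n + 3)) :
    Function.Bijective (evalMap R ω R) ∧
      ∀ j ≤ n, ExtVanishAt (Module.End R ω) (j + 1) (R →ₗ[R] ω) ω := by
  obtain ⟨C, f, ⟨e₀⟩, hinj, hexact, happ⟩ := h
  have hsub : ∀ i, Function.Injective (LinearMap.range (f i)).subtype := fun i =>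
    Subtype.val_injective
  have hsurj : ∀ i, Function.Surjective (f i).rangeRestrict := fun i =>
    (f i).surjective_rangeRestrict
  have hex : ∀ i, i + 1 < n + 3 →
      Function.Exact (LinearMap.range (f i)).subtype (f (i + 1)).rangeRestrict := by
    intro i hi c
    rw [Submodule.coe_subtype, Subtype.range_coe]
    refine Iff.trans ?_ (hexact i hi c)
    rw [Subtype.ext_iff]
    rfl
  have htors : ∀ i, i < n + 3 → Function.Injective (evalMap R ω (LinearMap.range (f i))) :=
    fun i hi => evalMap_injective_of_injective (hsub i) (happ i hi).1.evalMap_bijective.1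
  have hrefl : ∀ i, i + 1 < n + 3 → Function.Bijective (evalMap R ω (LinearMap.range (f i))) :=
    fun i hi => evalMap_bijective_left (hsub i) (hex i hi)
      (happ i (by omega)).exists_extension (happ i (by omega)).1.evalMap_bijective (htors _ hi)
  have hExt : ∀ j i, i + j + 2 < n + 3 →
      ExtVanishAt (Module.End R ω) (j + 1) (LinearMap.range (f i) →ₗ[R] ω) ω := by
    intro j
    induction j with
    | zero =>
      intro i hi
      exact extVanishAt_one_dual (hex i (by omega)) (hsurj _)
        (happ i (by omega)).exists_extension (hrefl _ (by omega)).2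
        ((happ i (by omega)).1.extVanishAt_dual 0)
    | succ j ih =>
      intro i hi
      exact extVanishAt_succ_dual (hex i (by omega)) (hsurj _)
        (happ i (by omega)).exists_extension (ih (i + 1) (by omega))
        ((happ i (by omega)).1.extVanishAt_dual (j + 1))
  let e : R ≃ₗ[R] LinearMap.range (f 0) :=
    e₀.symm.trans (LinearEquiv.ofInjective (f 0) (hinj (by omega)))
  constructor
  · exact evalMap_bijective_of_sum_comp_eq_id (ι := Unit) (fun _ => e.toLinearMap)
      (fun _ => e.symm.toLinearMap) (by simp) fun _ => hrefl 0 (by omega)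
  · intro j hj
    exact extVanishAt_dual_of_sum_comp_eq_id (ι := Unit) (fun _ => e.toLinearMap)
      (fun _ => e.symm.toLinearMap) (by simp) fun _ => hExt j 0 (by omega)

theorem IsWakamatsuTilting.isGDimZero_self (hω : IsWakamatsuTilting R ω) : IsGDimZero R ω R where
  finite := inferInstance
  reflexive := (hω.faithfulDim 3 (by omega)).self.1
  ext_eq_zero := ExtVanish.of_projective
  ext_dual_eq_zero i hi := by
    obtain ⟨i, rfl⟩ := Nat.exists_eq_add_of_le' hi
    exact (hω.faithfulDim (i + 3) (by omega)).self.2 i le_rfl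

theorem IsWakamatsuTilting.isGDimZero_of_projective (hω : IsWakamatsuTilting R ω) (P : Type u)
    [AddCommGroup P] [Module R P] [Module.Finite R P] [Module.Projective R P] :
    IsGDimZero R ω P := by
  obtain ⟨n, p, s, -, -, hps⟩ := Module.Finite.exists_comp_eq_id_of_projective R P
  exact IsGDimZero.of_sum_comp_eq_id (ι := Fin n) (G := fun _ => R)
    (fun k => LinearMap.proj k ∘ₗ s) (fun k => p ∘ₗ LinearMap.single R (fun _ => R) k)
    (sum_comp_single_proj hps) fun _ => hω.isGDimZero_self

end Wakamatsu

/-! ### Resolutions by modules of G-dimension zero -/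

section Resolutions

variable {R : Type u} [Ring R] {ω : Type u} [AddCommGroup ω] [Module R ω]
variable {M : Type u} [AddCommGroup M] [Module R M]

theorem hasGResolution_zero_iff : HasGResolution R ω M 0 ↔ IsGDimZero R ω M := by
  constructor
  · rintro ⟨G, d, ε, hG, hsub, -, hdε, hε⟩
    have hinj : Function.Injective ε := by
      rw [← LinearMap.ker_eq_bot, LinearMap.ker_eq_bot']
      intro x hx
      obtain ⟨y, rfl⟩ := (hdε x).1 hx
      rw [@Subsingleton.elim _ (hsub 1 one_pos) y 0, map_zero]
    exact (hG 0 le_rfl).congr (LinearEquiv.ofBijective ε ⟨hinj, hε⟩)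
  · intro h
    let G : ℕ → ModuleCat.{u} R
      | 0 => ModuleCat.of R M
      | _ + 1 => ModuleCat.of R PUnit
    have hsub : ∀ i, Subsingleton (G (i + 1)) := fun _ => inferInstanceAs (Subsingleton PUnit)
    refine ⟨G, fun _ => 0, (LinearMap.id : M →ₗ[R] M), ?_, ?_, ?_, ?_, fun m => ⟨m, rfl⟩⟩
    · intro i hi
      obtain rfl : i = 0 := by omega
      exact h
    · intro i hi
      obtain ⟨i, rfl⟩ := Nat.exists_eq_add_of_le' hi
      exact hsub i
    · intro i y
      exact iff_of_true rfl ⟨0, @Subsingleton.elim _ (hsub i) _ _⟩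
    · intro y
      exact ⟨fun hy => ⟨0, hy.symm⟩, fun ⟨_, hx⟩ => hx.symm⟩

/-- Splicing a short exact sequence `0 → K → G → M → 0` with a resolution of `K`. -/
theorem HasGResolution.of_shortExact {K G₀ : Type u} [AddCommGroup K] [Module R K]
    [AddCommGroup G₀] [Module R G₀] {f : K →ₗ[R] G₀} {g : G₀ →ₗ[R] M} (hf : Function.Injective f)
    (hfg : Function.Exact f g) (hg : Function.Surjective g) (hG₀ : IsGDimZero R ω G₀) {n : ℕ}
    (hK : HasGResolution R ω K n) : HasGResolution R ω M (n + 1) := by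
  obtain ⟨G, d, ε, hG, hsub, hd, hdε, hε⟩ := hK
  let G' : ℕ → ModuleCat.{u} R
    | 0 => ModuleCat.of R G₀
    | i + 1 => G i
  let d' : ∀ i, G' (i + 1) →ₗ[R] G' i
    | 0 => f ∘ₗ ε
    | i + 1 => d i
  refine ⟨G', d', g, ?_, ?_, ?_, ?_, hg⟩
  · rintro (_ | i) hi
    · exact hG₀
    · exact hG i (by omega)
  · rintro (_ | i) hi
    · omega
    · exact hsub i (by omega)
  · rintro (_ | i)
    · intro y
      refine Iff.trans ?_ (hdε y)
      exact ⟨fun h => hf (h.trans f.map_zero.symm), fun h => (congrArg f h).trans f.map_zero⟩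
    · exact hd i
  · intro y
    refine (hfg y).trans ⟨?_, ?_⟩
    · rintro ⟨k, rfl⟩
      obtain ⟨x, rfl⟩ := hε k
      exact ⟨x, rfl⟩
    · rintro ⟨x, rfl⟩
      exact ⟨ε x, rfl⟩

theorem HasGResolution.exists_shortExact {n : ℕ} (h : HasGResolution R ω M (n + 1)) :
    ∃ (G : ModuleCat.{u} R) (g : G →ₗ[R] M), Function.Surjective g ∧ IsGDimZero R ω G ∧
      HasGResolution R ω (LinearMap.ker g) n := by
  obtain ⟨G, d, ε, hG, hsub, hd, hdε, hε⟩ := h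
  refine ⟨G 0, ε, hε, hG 0 (by omega), fun i => G (i + 1), fun i => d (i + 1),
    (d 0).codRestrict (LinearMap.ker ε) (fun x => hdε.apply_apply_eq_zero x),
    fun i hi => hG _ (by omega), fun i hi => hsub _ (by omega), fun i => hd _, fun y => ?_, ?_⟩
  · rw [← hd 0 y, Subtype.ext_iff]
    rfl
  · rintro ⟨x, hx⟩
    obtain ⟨y, rfl⟩ := (hdε x).1 hx
    exact ⟨y, rfl⟩

/-- If `M` has a resolution of length `n + 1` by modules of G-dimension zero, then the kernel of
any surjection `P → M`, with `P` projective and of G-dimension zero, has one of length `n`. With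
`G → M` the first map of the given resolution, `M'` its kernel and `P → G` a lift of `P → M`, the
kernel `K` sits in `0 → K → M' × P → G → 0`; for `n > 0` and `G' → M'` the next map of the
resolution, the kernel `L` of `G' × P → G` has G-dimension zero and maps onto `K` with the same
kernel as `G' → M'`. -/
theorem HasGResolution.ker_of_projective [IsNoetherianRing R] {n : ℕ}
    (h : HasGResolution R ω M (n + 1)) {P : Type u} [AddCommGroup P] [Module R P]
    [Module.Projective R P] (hP : IsGDimZero R ω P) {p : P →ₗ[R] M} (hp : Function.Surjective p) :
    HasGResolution R ω (LinearMap.ker p) n := by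
  obtain ⟨G, g, hg, hG, hM'⟩ := h.exists_shortExact
  obtain ⟨s, rfl⟩ := Module.projective_lifting_property g p hg
  rcases n with _ | n
  · rw [hasGResolution_zero_iff] at hM' ⊢
    let K := LinearMap.ker (g ∘ₗ s)
    let j : K →ₗ[R] LinearMap.ker g × P := LinearMap.prod
      (-(s ∘ₗ K.subtype).codRestrict (LinearMap.ker g) (fun x => x.2)) K.subtype
    let q : LinearMap.ker g × P →ₗ[R] G := (LinearMap.ker g).subtype.coprod s
    have hj : Function.Injective j := fun x y hxy => Subtype.ext (congrArg Prod.snd hxy)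
    have hjq : Function.Exact j q := by
      rintro ⟨⟨m, hm⟩, y⟩
      constructor
      · intro hmy
        have hmy' : m + s y = 0 := hmy
        have hm' : m = -s y := eq_neg_of_add_eq_zero_left hmy'
        refine ⟨⟨y, ?_⟩, Prod.ext (Subtype.ext hm'.symm) rfl⟩
        rw [LinearMap.mem_ker, hm', map_neg, neg_eq_zero] at hm
        exact hm
      · rintro ⟨x, hx⟩
        rw [← hx]
        exact neg_add_cancel (s x)
    have hq : Function.Surjective q := by
      intro z
      obtain ⟨y, hy⟩ := hp (g z)
      refine ⟨(⟨z - s y, ?_⟩, y), sub_add_cancel z (s y)⟩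
      rw [LinearMap.mem_ker, map_sub, sub_eq_zero]
      exact hy.symm
    exact IsGDimZero.left hj hjq hq (hM'.prod hP) hG
  · obtain ⟨G', g', hg', hG', hM''⟩ := hM'.exists_shortExact
    let q : G' × P →ₗ[R] G := ((LinearMap.ker g).subtype ∘ₗ g').coprod s
    have hq : Function.Surjective q := by
      intro z
      obtain ⟨y, hy⟩ := hp (g z)
      obtain ⟨x, hx⟩ := hg' ⟨z - s y, by
        rw [LinearMap.mem_ker, map_sub, sub_eq_zero]
        exact hy.symm⟩
      refine ⟨(x, y), ?_⟩
      have : (g' x : G) = z - s y := congrArg Subtype.val hx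
      exact (congrArg (· + s y) this).trans (sub_add_cancel z (s y))
    let L := LinearMap.ker q
    have hL : IsGDimZero R ω L :=
      IsGDimZero.left (f := L.subtype) Subtype.val_injective (LinearMap.exact_subtype_ker_map q) hq
        (hG'.prod hP) hG
    have hmem : ∀ x : L, (g' x.1.1 : G) = -s x.1.2 := fun x => eq_neg_of_add_eq_zero_left x.2
    let r : L →ₗ[R] LinearMap.ker (g ∘ₗ s) :=
      (LinearMap.snd R G' P ∘ₗ L.subtype).codRestrict _ fun x => by
        have h0 : g (g' x.1.1 : G) = 0 := (g' x.1.1).2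
        rw [hmem, map_neg, neg_eq_zero] at h0
        exact h0
    have hr : Function.Surjective r := by
      rintro ⟨y, hy⟩
      obtain ⟨x, hx⟩ := hg' ⟨-s y, by
        rw [LinearMap.mem_ker, map_neg, neg_eq_zero]
        exact hy⟩
      refine ⟨⟨(x, y), ?_⟩, rfl⟩
      have : (g' x : G) = -s y := congrArg Subtype.val hx
      exact (congrArg (· + s y) this).trans (neg_add_cancel (s y))
    let j : LinearMap.ker g' →ₗ[R] L :=
      (LinearMap.inl R G' P ∘ₗ (LinearMap.ker g').subtype).codRestrict _ fun x => by
        have h0 : (g' x.1 : G) = 0 := congrArg Subtype.val x.2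
        exact (congrArg (· + s 0) h0).trans (by simp)
    have hj : Function.Injective j := fun x y hxy =>
      Subtype.ext (congrArg (fun z : L => z.1.1) hxy)
    have hjr : Function.Exact j r := by
      intro x
      constructor
      · intro hx
        have hx2 : x.1.2 = 0 := congrArg Subtype.val hx
        refine ⟨⟨x.1.1, Subtype.ext ?_⟩, Subtype.ext (Prod.ext rfl hx2.symm)⟩
        rw [hmem, hx2, map_zero, neg_zero]
        rfl
      · rintro ⟨y, rfl⟩
        rfl
    exact HasGResolution.of_shortExact hj hjr hr hL hM''

end Resolutions

/-! ### Frobenius extensions that are centrally projective -/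

section FrobeniusExtension

open TensorProduct

variable {R S : Type u} [Ring R] [Ring S] {l : R →+* S}

variable (l) in
/-- A Frobenius system of `l : R → S` for which `E` is a homomorphism of `R`-bimodules and the
dual bases commute with `R`. -/
structure CentralFrobeniusSystem (n : ℕ) extends FrobeniusSystem l n where
  E_mul : ∀ (s : S) (r : R), E (toRestrict l (s * l r)) = E (toRestrict l s) * r
  x_comm : ∀ k r, l r * x k = x k * l r
  y_comm : ∀ k r, l r * y k = y k * l r

/-- The isomorphism `Θ : S ≅ Hom_R(S, R)` gives `E = Θ 1`, and central projectivity gives elements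
`y k` commuting with `R` and bimodule maps `S → R` that form a projective basis of `S`; the
elements `x k` correspond to these maps under `Θ`, and they commute with `R` because the maps are
right `R`-linear. -/
theorem exists_centralFrobeniusSystem (hF : IsFrobeniusExtension l)
    (hC : IsCentrallyProjective l) : ∃ n, Nonempty (CentralFrobeniusSystem l n) := by
  obtain ⟨Θ, hΘ₁, hΘ₂⟩ := hF.exists_iso
  obtain ⟨n, i, p, hi, hp, hpi⟩ := hC
  have hiL : ∀ r s k, i (l r * s) k = r * i s k := fun r s k => by
    simpa using congrFun (hi r s 1) k
  have hiR : ∀ s r k, i (s * l r) k = i s k * r := fun s r k => by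
    simpa using congrFun (hi 1 s r) k
  have hpL : ∀ r v, p (fun k => r * v k) = l r * p v := fun r v => by
    simpa using hp r v 1
  have hpR : ∀ v r, p (fun k => v k * r) = p v * l r := fun v r => by
    simpa using hp 1 v r
  let y : Fin n → S := fun k => p (Pi.single k 1)
  have hyL : ∀ k r, l r * y k = p (Pi.single k r) := fun k r => by
    rw [← hpL]
    congr 1
    ext j
    by_cases h : j = k
    · subst h; simp
    · simp [h]
  have hyR : ∀ k r, y k * l r = p (Pi.single k r) := fun k r => by
    rw [← hpR]
    congr 1
    ext j
    by_cases h : j = k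
    · subst h; simp
    · simp [h]
  let c : Fin n → (Restrict l S →ₗ[R] R) := fun k =>
    { toFun := fun s => i s k
      map_add' := fun s t => congrFun (i.map_add s t) k
      map_smul' := fun r s => hiL r s k }
  let x : Fin n → S := fun k => Θ.symm (c k)
  have hΘ1 : ∀ s t : S, Θ s (toRestrict l t) = Θ 1 (toRestrict l (t * s)) := fun s t => by
    rw [← hΘ₁, mul_one]
  have hE : ∀ s k, Θ 1 (toRestrict l (s * x k)) = i s k := fun s k => by
    rw [← hΘ1]
    exact LinearMap.congr_fun (Θ.apply_symm_apply (c k)) (toRestrict l s)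
  have hEmul : ∀ (s : S) (r : R),
      Θ 1 (toRestrict l (s * l r)) = Θ 1 (toRestrict l s) * r := fun s r => by
    rw [← hΘ1, ← hΘ₂, one_mul]
  have hleft : ∀ b : S, ∑ k, l (Θ 1 (toRestrict l (b * x k))) * y k = b := fun b => by
    simp only [hE, hyL]
    rw [← map_sum, Finset.univ_sum_single, hpi]
  refine ⟨n, ⟨⟨⟨Θ 1, x, y, hleft, ?_⟩, hEmul, ?_,
    fun k r => (hyL k r).trans (hyR k r).symm⟩⟩⟩
  · intro b
    apply Θ.injective
    refine LinearMap.ext fun t => ?_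
    change Θ _ (toRestrict l (ofRestrict l t)) = Θ _ (toRestrict l (ofRestrict l t))
    generalize ofRestrict l t = t
    rw [hΘ1, hΘ1 b]
    have hlin : ∀ (r : R) (s : S), Θ 1 (toRestrict l (l r * s)) = r * Θ 1 (toRestrict l s) :=
      fun r s => (Θ 1).map_smul r (toRestrict l s)
    have hsum : ∀ g : Fin n → S,
        Θ 1 (toRestrict l (∑ k, g k)) = ∑ k, Θ 1 (toRestrict l (g k)) :=
      fun g => map_sum (Θ 1) (fun k => toRestrict l (g k)) _
    conv_rhs => rw [← hleft t, Finset.sum_mul, hsum]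
    rw [Finset.mul_sum, hsum]
    refine Finset.sum_congr rfl fun k _ => ?_
    rw [← mul_assoc, hEmul, mul_assoc, hlin]
  · intro k r
    apply Θ.injective
    refine LinearMap.ext fun t => ?_
    change Θ _ (toRestrict l (ofRestrict l t)) = Θ _ (toRestrict l (ofRestrict l t))
    generalize ofRestrict l t = t
    rw [hΘ1, hΘ1 (x k * l r), ← mul_assoc, hE, ← mul_assoc, hEmul, hE, hiR]

end FrobeniusExtension

/-! ### The induced module -/

namespace Induced

open TensorProduct

variable {R S : Type u} [Ring R] [Ring S] {l : R →+* S} {ω : Type u} [AddCommGroup ω] [Module R ω]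

variable (l) in
/-- The class of `s ⊗ v` in the induced module. -/
def tmul (s : S) (v : ω) : Induced l ω :=
  Submodule.Quotient.mk (s ⊗ₜ[ℤ] v)

theorem tmul_add (s : S) (v w : ω) : tmul l s (v + w) = tmul l s v + tmul l s w := by
  simp [tmul, TensorProduct.tmul_add]

theorem add_tmul (s t : S) (v : ω) : tmul l (s + t) v = tmul l s v + tmul l t v := by
  simp [tmul, TensorProduct.add_tmul]

variable (l ω) in
/-- The biadditive map `s, v ↦ s ⊗ v`. -/
def tmulHom : S →+ ω →+ Induced l ω :=
  AddMonoidHom.mk' (fun s => AddMonoidHom.mk' (tmul l s) (tmul_add s)) fun s t =>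
    AddMonoidHom.ext fun v => add_tmul s t v

theorem sum_tmul {ι : Type*} (u : Finset ι) (s : ι → S) (v : ω) :
    tmul l (∑ k ∈ u, s k) v = ∑ k ∈ u, tmul l (s k) v :=
  map_sum ((tmulHom l ω).flip v) s u

theorem smul_tmul (s t : S) (v : ω) : s • tmul l t v = tmul l (s * t) v := rfl

theorem mul_tmul (s : S) (r : R) (v : ω) : tmul l (s * l r) v = tmul l s (r • v) := by
  rw [tmul, tmul, Submodule.Quotient.eq]
  exact Submodule.subset_span ⟨s, r, v, rfl⟩

theorem induction_on {P : Induced l ω → Prop} (w : Induced l ω)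
    (h : ∀ s v, P (tmul l s v)) (h_add : ∀ w w', P w → P w' → P (w + w')) : P w := by
  obtain ⟨z, rfl⟩ := Submodule.Quotient.mk_surjective _ w
  induction z with
  | zero => simpa [tmul] using h 0 0
  | tmul s v => exact h s v
  | add z z' hz hz' => exact h_add _ _ hz hz'

/-- The additive map out of the induced module given by an `R`-balanced biadditive map. -/
def lift {W : Type u} [AddCommGroup W] (b : S →+ ω →+ W)
    (hb : ∀ s r v, b (s * l r) v = b s (r • v)) : Induced l ω →+ W :=
  let B : S ⊗[ℤ] ω →+ W := TensorProduct.liftAddHom b fun m s v => by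
    rw [map_zsmul, map_zsmul]
    rfl
  QuotientAddGroup.lift (Submodule.toAddSubgroup _) B fun z hz => by
    -- The generators of the submodule are stable under `S`, although `B` is only additive.
    have key : ∀ t : S, B (t • z) = 0 := by
      refine Submodule.span_induction (p := fun z _ => ∀ t : S, B (t • z) = 0) ?_ ?_ ?_ ?_ hz
      · rintro _ ⟨s, r, v, rfl⟩ t
        rw [smul_sub, map_sub, sub_eq_zero]
        simpa [B, TensorProduct.smul_tmul', mul_assoc] using hb (t * s) r v
      · simp
      · intro z z' _ _ h h' t
        rw [smul_add, map_add, h, h', add_zero]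
      · intro s z _ h t
        rw [← mul_smul, h]
    simpa using key 1

@[simp]
theorem lift_tmul {W : Type u} [AddCommGroup W] (b : S →+ ω →+ W)
    (hb : ∀ s r v, b (s * l r) v = b s (r • v)) (s : S) (v : ω) :
    lift b hb (tmul l s v) = b s v := by
  rfl

theorem end_ext {u u' : Module.End S (Induced l ω)} (h : ∀ v, u (tmul l 1 v) = u' (tmul l 1 v)) :
    u = u' := by
  refine LinearMap.ext fun w => induction_on (P := fun w => u w = u' w) w (fun s v => ?_)
    fun w w' hw hw' => ?_
  · rw [← mul_one s, ← smul_tmul, map_smul, map_smul, h]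
  · rw [map_add, map_add, hw, hw']

/-- The endomorphism of the induced module given by an `R`-balanced biadditive map that is
`S`-linear in the first variable. -/
def liftEnd (b : S →+ ω →+ Induced l ω) (hb : ∀ s r v, b (s * l r) v = b s (r • v))
    (hs : ∀ t s v, b (t * s) v = t • b s v) : Module.End S (Induced l ω) where
  toFun := lift b hb
  map_add' := map_add _
  map_smul' t w := by
    refine induction_on (P := fun w => lift b hb (t • w) = t • lift b hb w) w (fun s v => ?_)
      fun w w' hw hw' => ?_
    · rw [smul_tmul, lift_tmul, lift_tmul, hs]
    · rw [smul_add, map_add, map_add, smul_add, hw, hw']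

variable (l ω) in
/-- The ring homomorphism `t ↦ S ⊗ t` from `End_R(ω)` to the endomorphism ring of the induced
module. -/
def mapEnd : Module.End R ω →+* Module.End S (Induced l ω) where
  toFun t := liftEnd ((tmulHom l ω).compl₂ t.toAddMonoidHom)
    (fun s r v => (mul_tmul s r (t v)).trans (congrArg (tmul l s) (t.map_smul r v).symm))
    fun _ _ _ => rfl
  map_one' := end_ext fun _ => rfl
  map_mul' _ _ := end_ext fun _ => rfl
  map_zero' := end_ext fun _ => (tmulHom l ω 1).map_zero
  map_add' _ _ := end_ext fun _ => tmul_add _ _ _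

variable (ω) in
/-- Right multiplication `s ⊗ v ↦ s * c ⊗ v` by an element `c` of `S` commuting with `R`. -/
def mulRightEnd (c : S) (hc : ∀ r, l r * c = c * l r) : Module.End S (Induced l ω) :=
  liftEnd ((tmulHom l ω).comp (AddMonoidHom.mulRight c))
    (fun s r v => by
      change tmul l (s * l r * c) v = tmul l (s * c) (r • v)
      rw [mul_assoc, hc, ← mul_assoc, mul_tmul])
    fun t s v => by
      change tmul l (t * s * c) v = t • tmul l (s * c) v
      rw [smul_tmul, mul_assoc]

theorem mulRightEnd_tmul (c : S) (hc : ∀ r, l r * c = c * l r) (s : S) (v : ω) :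
    mulRightEnd ω c hc (tmul l s v) = tmul l (s * c) v := rfl

end Induced

/-! ### The induced module is coinduced, over both rings -/

namespace CentralFrobeniusSystem

open Induced

variable {R S : Type u} [Ring R] [Ring S] {l : R →+* S} {n : ℕ} (F : CentralFrobeniusSystem l n)
  (ω : Type u) [AddCommGroup ω] [Module R ω]

/-- The map `s ⊗ v ↦ E s • v` through which the induced module is coinduced from `ω`. -/
def counit : Restrict l (Induced l ω) →ₗ[R] ω :=
  let b : S →+ ω →+ ω := (smulAddHom R ω).comp
    (AddMonoidHom.mk' (fun s => F.E (toRestrict l s)) fun _ _ => F.E.map_add _ _)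
  let π : Induced l ω →+ ω := lift b fun s r v => by
    change F.E (toRestrict l (s * l r)) • v = F.E (toRestrict l s) • r • v
    rw [F.E_mul, mul_smul]
  { toFun := π
    map_add' := π.map_add
    map_smul' := fun r w => induction_on (P := fun w => π (l r • w) = r • π w) w
      (fun s v => by
        change F.E (r • toRestrict l s) • v = r • F.E (toRestrict l s) • v
        rw [map_smul, smul_eq_mul, mul_smul])
      fun w w' hw hw' => by rw [smul_add, map_add, map_add, smul_add, hw, hw'] }

theorem counit_tmul (s : S) (v : ω) :
    F.counit ω (toRestrict l (tmul l s v)) = F.E (toRestrict l s) • v := rfl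

/-- The map `v ↦ 1 ⊗ v`. -/
def unit (l : R →+* S) (ω : Type u) [AddCommGroup ω] [Module R ω] :
    ω →ₗ[R] Restrict l (Induced l ω) where
  toFun v := toRestrict l (tmul l 1 v)
  map_add' := tmul_add 1
  map_smul' r v := by
    change tmul l 1 (r • v) = l r • tmul l 1 v
    rw [smul_tmul, mul_one, ← mul_tmul, one_mul]

/-- Expansion of the elements of the induced module with the dual bases of `S`. -/
theorem sum_smul_tmul_counit (w : Induced l ω) :
    ∑ k, F.x k • tmul l 1 (F.counit ω (toRestrict l (F.y k • w))) = w := by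
  let π : Induced l ω → ω := fun w => F.counit ω (toRestrict l w)
  have hπ : ∀ w w', π (w + w') = π w + π w' := (F.counit ω).map_add
  refine induction_on (P := fun w => ∑ k, F.x k • tmul l 1 (π (F.y k • w)) = w) w
    (fun s v => ?_) fun w w' hw hw' => ?_
  · conv_rhs => rw [← F.sum_right s, sum_tmul]
    refine Finset.sum_congr rfl fun k _ => ?_
    rw [smul_tmul, mul_one, mul_tmul]
    rfl
  · simp only [smul_add, hπ, tmul_add, Finset.sum_add_distrib, hw, hw']

theorem isCoinduced_counit : IsCoinduced l (F.counit ω) := by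
  refine F.toFrobeniusSystem.isCoinduced (unit l ω) (fun s v => ?_) (F.sum_smul_tmul_counit ω)
  change F.counit ω (toRestrict l (tmul l (s * 1) v)) = _
  rw [counit_tmul, mul_one]

/-- The map `s ⊗ v ↦ E s • v`, as a map of modules over `End_R(ω)`. -/
def counitEnd : Restrict (mapEnd l ω) (Induced l ω) →ₗ[Module.End R ω] ω where
  toFun w := F.counit ω (toRestrict l (ofRestrict (mapEnd l ω) w))
  map_add' := (F.counit ω).map_add
  map_smul' t w := by
    let π : Induced l ω → ω := fun w => F.counit ω (toRestrict l w)
    have hπ : ∀ w w', π (w + w') = π w + π w' := (F.counit ω).map_add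
    refine induction_on (P := fun w => π (mapEnd l ω t w) = t (π w)) w
      (fun s v => (t.map_smul (F.E (toRestrict l s)) v).symm) fun w w' hw hw' => ?_
    rw [map_add, hπ, hπ, map_add, hw, hw']

/-- The map `v ↦ 1 ⊗ v`, as a map of modules over `End_R(ω)`. -/
def unitEnd (l : R →+* S) (ω : Type u) [AddCommGroup ω] [Module R ω] :
    ω →ₗ[Module.End R ω] Restrict (mapEnd l ω) (Induced l ω) where
  toFun v := toRestrict (mapEnd l ω) (tmul l 1 v)
  map_add' := tmul_add 1
  map_smul' _ _ := rfl

/-- Expansion with the dual bases used in the opposite order, for right multiplications. -/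
theorem sum_mulRightEnd (w : Induced l ω) :
    ∑ k, mulRightEnd ω (F.y k) (F.y_comm k)
      (tmul l 1 (F.counit ω (toRestrict l (mulRightEnd ω (F.x k) (F.x_comm k) w)))) = w := by
  let π : Induced l ω → ω := fun w => F.counit ω (toRestrict l w)
  have hπ : ∀ w w', π (w + w') = π w + π w' := (F.counit ω).map_add
  refine induction_on (P := fun w => ∑ k, mulRightEnd ω (F.y k) (F.y_comm k)
    (tmul l 1 (π (mulRightEnd ω (F.x k) (F.x_comm k) w))) = w) w
    (fun s v => ?_) fun w w' hw hw' => ?_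
  · conv_rhs => rw [← F.sum_left s, sum_tmul]
    refine Finset.sum_congr rfl fun k _ => ?_
    rw [F.y_comm, mul_tmul, mulRightEnd_tmul, one_mul, mulRightEnd_tmul]
    rfl
  · simp only [map_add, hπ, tmul_add, Finset.sum_add_distrib, hw, hw']

/-- A Frobenius system of `End_R(ω) → End_S(S ⊗_R ω)`. Its dual bases are the right
multiplications by the dual bases of `S`, in the opposite order. -/
def endSystem : FrobeniusSystem (mapEnd l ω) n where
  E :=
    { toFun := fun u => F.counit ω ∘ₗ
        restrictMap l (ofRestrict (mapEnd l ω) u : Module.End S (Induced l ω)) ∘ₗ unit l ω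
      map_add' := fun u u' => LinearMap.ext fun v => (F.counit ω).map_add _ _
      map_smul' := fun t u => LinearMap.ext fun v => (F.counitEnd ω).map_smul t _ }
  x k := mulRightEnd ω (F.y k) (F.y_comm k)
  y k := mulRightEnd ω (F.x k) (F.x_comm k)
  sum_left u := by
    refine end_ext fun v => ?_
    conv_rhs => rw [← F.sum_smul_tmul_counit ω (u (tmul l 1 v))]
    rw [LinearMap.sum_apply]
    refine Finset.sum_congr rfl fun k _ => ?_
    change tmul l (1 * F.x k) (F.counit ω (toRestrict l (u (tmul l (1 * F.y k) v)))) = _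
    rw [smul_tmul, ← map_smul, smul_tmul, one_mul, one_mul, mul_one, mul_one]
  sum_right u := by
    refine end_ext fun v => ?_
    rw [LinearMap.sum_apply]
    exact F.sum_mulRightEnd ω (u (tmul l 1 v))

theorem isCoinduced_counitEnd : IsCoinduced (mapEnd l ω) (F.counitEnd ω) :=
  (F.endSystem ω).isCoinduced (unitEnd l ω) (fun _ _ => rfl) (F.sum_mulRightEnd ω)

/-! ### Comparison of G-dimensions -/

section Comparison

variable (M : Type u) [AddCommGroup M] [Module S M]

/-- The isomorphism `Hom_S(M, S ⊗_R ω) ≅ Hom_R(M, ω)`, as modules over `End_R(ω)`. -/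
noncomputable def dualEquiv :
    Restrict (mapEnd l ω) (M →ₗ[S] Induced l ω) ≃ₗ[Module.End R ω] (Restrict l M →ₗ[R] ω) :=
  LinearEquiv.ofBijective
    { toFun := fun f => F.counit ω ∘ₗ
        restrictMap l (ofRestrict (mapEnd l ω) f : M →ₗ[S] Induced l ω)
      map_add' := fun _ _ => LinearMap.ext fun _ => (F.counit ω).map_add _ _
      map_smul' := fun t _ => LinearMap.ext fun _ => (F.counitEnd ω).map_smul t _ }
    (F.isCoinduced_counit ω M)

include F

/-- Both evaluation maps become `m ↦ (f ↦ π (f m))`, with `π : S ⊗_R ω → ω` the counit. -/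
theorem evalMap_bijective_iff : Function.Bijective (evalMap S (Induced l ω) M) ↔
    Function.Bijective (evalMap R ω (Restrict l M)) := by
  let α : ((M →ₗ[S] Induced l ω) →ₗ[Module.End S (Induced l ω)] Induced l ω) →
      (Restrict (mapEnd l ω) (M →ₗ[S] Induced l ω) →ₗ[Module.End R ω] ω) :=
    fun f => F.counitEnd ω ∘ₗ restrictMap (mapEnd l ω) f
  let β : ((Restrict l M →ₗ[R] ω) →ₗ[Module.End R ω] ω) →
      (Restrict (mapEnd l ω) (M →ₗ[S] Induced l ω) →ₗ[Module.End R ω] ω) :=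
    fun f => f ∘ₗ (F.dualEquiv ω M).toLinearMap
  have hα : Function.Bijective α := F.isCoinduced_counitEnd ω (M →ₗ[S] Induced l ω)
  have hβ : Function.Bijective β := by
    refine ⟨fun f f' h => LinearMap.ext fun x => ?_, fun f => ?_⟩
    · simpa [β] using LinearMap.congr_fun h ((F.dualEquiv ω M).symm x)
    · exact ⟨f ∘ₗ (F.dualEquiv ω M).symm.toLinearMap, LinearMap.ext fun x => by simp [β]⟩
  -- `α` after the left evaluation map is definitionally `β` after the right one.
  exact (hα.of_comp_iff' (evalMap S (Induced l ω) M)).symm.trans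
    (hβ.of_comp_iff' (evalMap R ω (Restrict l M)))

theorem finite_iff : Module.Finite S M ↔ Module.Finite R (Restrict l M) := by
  refine ⟨fun _ => F.finite_restrict M, fun h => ?_⟩
  obtain ⟨m, g, hg⟩ := Module.Finite.exists_fin' R (Restrict l M)
  refine Module.Finite.of_surjective (M := Fin m → S)
    (Fintype.linearCombination S fun j => ofRestrict l (g (Pi.single j 1))) fun z => ?_
  obtain ⟨v, rfl⟩ := hg z
  refine ⟨fun j => l (v j), ?_⟩
  conv_rhs => rw [← Finset.univ_sum_single v, map_sum]
  rw [Fintype.linearCombination_apply]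
  refine Finset.sum_congr rfl fun j _ => ?_
  refine (g.map_smul (v j) (Pi.single j 1)).symm.trans ?_
  rw [← Pi.single_smul, smul_eq_mul, mul_one]

/-- An `S`-module has G-dimension zero with respect to `S ⊗_R ω` if and only if its underlying
`R`-module has G-dimension zero with respect to `ω`. -/
theorem isGDimZero_iff : IsGDimZero S (Induced l ω) M ↔ IsGDimZero R ω (Restrict l M) := by
  have := F.toFrobeniusSystem.projective
  have := (F.endSystem ω).projective
  have hExt := (F.isCoinduced_counit ω).extVanish_iff M
  have hdual := (F.isCoinduced_counitEnd ω).extVanish_iff (M →ₗ[S] Induced l ω)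
  constructor
  · rintro ⟨h₁, h₂, h₃, h₄⟩
    exact ⟨(F.finite_iff M).1 h₁, (F.evalMap_bijective_iff ω M).1 h₂, hExt.1 h₃,
      (hdual.1 h₄).congr (F.dualEquiv ω M)⟩
  · rintro ⟨h₁, h₂, h₃, h₄⟩
    exact ⟨(F.finite_iff M).2 h₁, (F.evalMap_bijective_iff ω M).2 h₂, hExt.2 h₃,
      hdual.2 (h₄.congr (F.dualEquiv ω M).symm)⟩

theorem hasGResolution_restrict {n : ℕ} (h : HasGResolution S (Induced l ω) M n) :
    HasGResolution R ω (Restrict l M) n := by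
  obtain ⟨G, d, ε, hG, hsub, hd, hdε, hε⟩ := h
  exact ⟨fun i => ModuleCat.of R (Restrict l (G i)),
    fun i => restrictMap l (M := G (i + 1)) (N := G i) (d i), restrictMap l (M := G 0) ε,
    fun i hi => (F.isGDimZero_iff ω (G i)).1 (hG i hi), hsub, hd, hdε, hε⟩

/-- For the converse of `hasGResolution_restrict`, resolve `M` by free `S`-modules: the underlying
`R`-modules are projective, so the `n`-th syzygy has G-dimension zero over `R`, hence over `S`. -/
theorem hasGResolution_of_restrict [IsNoetherianRing R] [IsNoetherianRing S]
    (hω : IsWakamatsuTilting R ω) [Module.Finite S M] {n : ℕ}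
    (h : HasGResolution R ω (Restrict l M) n) : HasGResolution S (Induced l ω) M n := by
  induction n generalizing M with
  | zero =>
    rw [hasGResolution_zero_iff] at h ⊢
    exact (F.isGDimZero_iff ω M).2 h
  | succ n ih =>
    obtain ⟨m, g, hg⟩ := Module.Finite.exists_fin' S M
    have := F.toFrobeniusSystem.projective
    have := projective_restrict l (Fin m → S)
    have := F.finite_restrict (Fin m → S)
    have hP := hω.isGDimZero_of_projective (Restrict l (Fin m → S))
    have hK : HasGResolution R ω (Restrict l (LinearMap.ker g)) n :=
      h.ker_of_projective hP (p := restrictMap l g) hg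
    exact HasGResolution.of_shortExact (f := (LinearMap.ker g).subtype) Subtype.val_injective
      (LinearMap.exact_subtype_ker_map g) hg ((F.isGDimZero_iff ω _).2 hP) (ih _ hK)

end Comparison

end CentralFrobeniusSystem

end RelG

theorem theorem5p9 {R S : Type u} [Ring R] [Ring S]
    [IsNoetherianRing R] [IsNoetherianRing Rᵐᵒᵖ] [IsNoetherianRing S] [IsNoetherianRing Sᵐᵒᵖ]
    (l : R →+* S) (hF : RelG.IsFrobeniusExtension l) (hC : RelG.IsCentrallyProjective l)
    (ω : Type u) [AddCommGroup ω] [Module R ω] (hω : RelG.IsWakamatsuTilting R ω)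
    (M : Type u) [AddCommGroup M] [Module S M] [Module.Finite S M] :
    RelG.gDim S (RelG.Induced l ω) M = RelG.gDim R ω (RelG.Restrict l M) := by
  obtain ⟨n, ⟨F⟩⟩ := RelG.exists_centralFrobeniusSystem hF hC
  have h : ∀ n, RelG.HasGResolution S (RelG.Induced l ω) M n ↔
      RelG.HasGResolution R ω (RelG.Restrict l M) n := fun n =>
    ⟨F.hasGResolution_restrict ω M, F.hasGResolution_of_restrict ω M hω⟩
  simp only [RelG.gDim, h]
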